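/- Let $\nu$ be a real number with $|\nu|<\frac12$ and let $$\mathbf{H}_\nu(x)=\sum_{n\ge 0}\frac{(-1)^n}{\Gamma\left(n+\frac32\right)\Gamma\left(n+\nu+\frac32\right)}\left(\frac{x}{2}\right)^{2n+\nu+1},\qquad x>0,$$ be the Struve function of the first kind of order $\nu$. Then the derivative $\mathbf{H}_\nu'$ has a smallest positive zero $h'_{\nu,1}$, and it satisfies the lower bounds $$(h'_{\nu,1})^2>\frac{3(2\nu+3)(\nu+1)}{\nu+3},$$ $$(h'_{\nu,1})^2>\frac{3(2\nu+3)(\nu+1)\sqrt{5(2\nu+5)}}{\sqrt{-2\nu^3-5\nu^2+72\nu+135}},$$ $$(h'_{\nu,1})^2>\frac{3(2\nu+3)(\nu+1)\sqrt[3]{35(2\nu+5)(2\nu+7)}}{\sqrt[3]{-4\nu^5-132\nu^4-1115\nu^3+621\nu^2+12339\nu+14931}}$$ and the upper bounds $$(h'_{\nu,1})^2<\frac{15(2\nu+3)(2\nu+5)(\nu+1)(\nu+3)}{-2\nu^3-5\nu^2+72\nu+135},$$ $$(h'_{\nu,1})^2<\frac{21(2\nu+3)(2\nu+7)(\nu+1)(-2\nu^3-5\nu^2+72\nu+135)}{-4\nu^5-132\nu^4-1115\nu^3+621\nu^2+12339\nu+14931}.$$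 -/

import Mathlib

/-- The Struve function of the first kind `𝐇_ν(x)`, for real order `ν` and real argument `x`,
through its series; the real power is the ordinary one for `x > 0`. -/
noncomputable def struveH (ν x : ℝ) : ℝ :=
  ∑' n : ℕ, (-1 : ℝ) ^ n / (Real.Gamma ((n : ℝ) + 3 / 2) * Real.Gamma ((n : ℝ) + ν + 3 / 2)) *
    (x / 2) ^ (2 * (n : ℝ) + ν + 1)

/-!
For `x > 0` the derivative of the Struve function is a positive multiple of `f(x²)`, where
`f(z) = ∑ (-1)ⁿ (2n+ν+1) cₙ zⁿ` and `cₙ = 1 / ∏_{k<n} (2k+3)(2k+2ν+3)` (`deriv_struveH`).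
The stated bounds are the Euler–Rayleigh bounds built from the power sums of the reciprocal zeros
of `f`, but neither the reality of these zeros nor a product expansion of `f` is needed here: two
explicit polynomials in `ν` separate the bounds from the first zero `z₁` of `f`.

In the scale `D = 3(2ν+3)(ν+1)` the first zero varies slowly with `ν`. The cubic `lowerProfile` and
the quadratic `upperProfile` satisfy
`(lower bounds) < D * lowerProfile < z₁ < D * upperProfile < (upper bounds)`.
The outer inequalities are polynomial inequalities in `ν`. For the inner ones, the series alternates
with decreasing terms (`struveDerivSeries_bounds`), so `f` lies above its partial sum of degree `5`
and below the one of degree `4`. The first is decreasing up to `D * lowerProfile`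
(`truncation_antitone`) and positive there, hence `f > 0` on `(0, D * lowerProfile]`
(`struveDerivSeries_pos`); the second is negative at `D * upperProfile` (`struveDerivSeries_neg`).
The intermediate value theorem gives the smallest zero (`exists_isLeast_pos_zero`).

Each polynomial inequality on `|ν| < 1/2` becomes, under `ν + 1/2 = u / (u + 1)` with `u > 0`, the
positivity of a polynomial in `u` all of whose coefficients are positive.
-/

open Filter Topology Finset

/-! ### The power series of the derivative -/

/-- The moduli `1 / ∏_{k<n} (2k+3)(2k+2ν+3)` of the Taylor coefficients of
`x ↦ x ^ (-ν - 1) * struveH ν x` in the variable `x ^ 2`, normalized to start with `1`. -/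
noncomputable def struveCoeff (ν : ℝ) (n : ℕ) : ℝ :=
  1 / ∏ k ∈ range n, ((2 * (k : ℝ) + 3) * (2 * (k : ℝ) + 2 * ν + 3))

/-- For `z ≥ 0`, the modulus of the `n`-th term of the alternating series `struveDerivSeries ν z`. -/
noncomputable def struveDerivTerm (ν z : ℝ) (n : ℕ) : ℝ :=
  (2 * (n : ℝ) + ν + 1) * struveCoeff ν n * z ^ n

/-- The entire function `∑ (-1)ⁿ (2n+ν+1) cₙ zⁿ`, with `cₙ = struveCoeff ν n`. For `x > 0` its value at
`x ^ 2` is the derivative of `struveH ν` at `x` up to the positive factor in `deriv_struveH`. -/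
noncomputable def struveDerivSeries (ν z : ℝ) : ℝ :=
  ∑' n : ℕ, (-1 : ℝ) ^ n * struveDerivTerm ν z n

theorem struveCoeff_zero (ν : ℝ) : struveCoeff ν 0 = 1 := by simp [struveCoeff]

theorem struveCoeff_succ (ν : ℝ) (n : ℕ) :
    struveCoeff ν (n + 1) =
      struveCoeff ν n / ((2 * (n : ℝ) + 3) * (2 * (n : ℝ) + 2 * ν + 3)) := by
  rw [struveCoeff, struveCoeff, prod_range_succ, one_div, one_div, mul_inv, div_eq_mul_inv]

theorem struveCoeff_pos {ν : ℝ} (hν : |ν| < 1 / 2) (n : ℕ) : 0 < struveCoeff ν n := by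
  have h1 := (abs_lt.1 hν).1
  refine one_div_pos.2 (prod_pos fun k _ => mul_pos (by positivity) ?_)
  have : (0 : ℝ) ≤ k := k.cast_nonneg
  linarith

theorem struveCoeff_le {ν : ℝ} (hν : |ν| < 1 / 2) (n : ℕ) :
    struveCoeff ν n ≤ 1 / (2 ^ n * n.factorial) := by
  have h1 := (abs_lt.1 hν).1
  induction n with
  | zero => simp [struveCoeff_zero]
  | succ n ih =>
    have hn : (0 : ℝ) ≤ n := n.cast_nonneg
    rw [struveCoeff_succ, Nat.factorial_succ, pow_succ]
    push_cast
    have hq : 2 * ((n : ℝ) + 1) ≤ (2 * (n : ℝ) + 3) * (2 * (n : ℝ) + 2 * ν + 3) := by nlinarith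
    calc _ ≤ (1 / (2 ^ n * n.factorial)) / (2 * ((n : ℝ) + 1)) := by gcongr
      _ = _ := by field_simp

theorem struveDerivTerm_nonneg {ν : ℝ} (hν : |ν| < 1 / 2) {z : ℝ} (hz : 0 ≤ z) (n : ℕ) :
    0 ≤ struveDerivTerm ν z n := by
  have h1 := (abs_lt.1 hν).1
  have hn : (0 : ℝ) ≤ n := n.cast_nonneg
  have := struveCoeff_pos hν n
  have : 0 ≤ 2 * (n : ℝ) + ν + 1 := by linarith
  unfold struveDerivTerm
  positivity

theorem summable_struveDerivTerm {ν : ℝ} (hν : |ν| < 1 / 2) {z : ℝ} (hz : 0 ≤ z) :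
    Summable (struveDerivTerm ν z) := by
  obtain ⟨h1, h2⟩ := abs_lt.1 hν
  refine Summable.of_nonneg_of_le (struveDerivTerm_nonneg hν hz) (fun n => ?_)
    ((Real.summable_pow_div_factorial z).mul_left 2)
  have hn : (0 : ℝ) ≤ n := n.cast_nonneg
  have hp : (n : ℝ) + 1 ≤ 2 ^ n := by exact_mod_cast Nat.lt_two_pow_self
  have hc := struveCoeff_pos hν n
  calc struveDerivTerm ν z n ≤ (2 * 2 ^ n) * (1 / (2 ^ n * n.factorial)) * z ^ n := by
        unfold struveDerivTerm
        gcongr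
        · linarith
        · exact struveCoeff_le hν n
    _ = 2 * (z ^ n / n.factorial) := by field_simp

theorem hasSum_struveDerivSeries {ν : ℝ} (hν : |ν| < 1 / 2) {z : ℝ} (hz : 0 ≤ z) :
    HasSum (fun n : ℕ => (-1 : ℝ) ^ n * struveDerivTerm ν z n) (struveDerivSeries ν z) := by
  refine Summable.hasSum (Summable.of_norm ?_)
  simpa [abs_of_nonneg (struveDerivTerm_nonneg hν hz _)] using summable_struveDerivTerm hν hz

theorem continuous_struveDerivSeries_sq {ν : ℝ} (hν : |ν| < 1 / 2) :
    Continuous fun x : ℝ => struveDerivSeries ν (x ^ 2) := by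
  refine continuous_iff_continuousAt.2 fun x => ?_
  have hx : |x| < |x| + 1 := by linarith
  refine ContinuousOn.continuousAt (s := Set.Icc (-(|x| + 1)) (|x| + 1)) ?_
    (Icc_mem_nhds (abs_lt.1 hx).1 (abs_lt.1 hx).2)
  refine continuousOn_tsum (u := struveDerivTerm ν ((|x| + 1) ^ 2)) (fun n => ?_)
    (summable_struveDerivTerm hν (by positivity)) fun n y hy => ?_
  · unfold struveDerivTerm
    fun_prop
  · have h1 := (abs_lt.1 hν).1
    have hn : (0 : ℝ) ≤ n := n.cast_nonneg
    have hc := struveCoeff_pos hν n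
    have hl : 0 ≤ 2 * (n : ℝ) + ν + 1 := by linarith
    have hy2 : y ^ 2 ≤ (|x| + 1) ^ 2 := sq_le_sq' hy.1 hy.2
    rw [norm_mul, norm_pow, norm_neg, norm_one, one_pow, one_mul, Real.norm_eq_abs,
      abs_of_nonneg (struveDerivTerm_nonneg hν (sq_nonneg y) n)]
    unfold struveDerivTerm
    gcongr

/-- The functional equation of `Γ` turns the coefficients of the Struve series into the rational
numbers `struveCoeff ν n`, up to one constant. -/
theorem one_div_Gamma_mul_Gamma {ν : ℝ} (hν : |ν| < 1 / 2) (n : ℕ) :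
    1 / (Real.Gamma ((n : ℝ) + 3 / 2) * Real.Gamma ((n : ℝ) + ν + 3 / 2)) =
      1 / (Real.Gamma (3 / 2) * Real.Gamma (ν + 3 / 2)) * (4 ^ n * struveCoeff ν n) := by
  have h1 := (abs_lt.1 hν).1
  induction n with
  | zero => simp [struveCoeff_zero]
  | succ n ih =>
    have hn : (0 : ℝ) ≤ n := n.cast_nonneg
    have e1 : ((n + 1 : ℕ) : ℝ) + 3 / 2 = ((n : ℝ) + 3 / 2) + 1 := by push_cast; ring
    have e2 : ((n + 1 : ℕ) : ℝ) + ν + 3 / 2 = ((n : ℝ) + ν + 3 / 2) + 1 := by push_cast; ring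
    have p1 : 0 < (n : ℝ) + 3 / 2 := by linarith
    have p2 : 0 < (n : ℝ) + ν + 3 / 2 := by linarith
    rw [e1, e2, Real.Gamma_add_one p1.ne', Real.Gamma_add_one p2.ne', struveCoeff_succ]
    calc _ = 1 / (Real.Gamma ((n : ℝ) + 3 / 2) * Real.Gamma ((n : ℝ) + ν + 3 / 2)) *
          (1 / (((n : ℝ) + 3 / 2) * ((n : ℝ) + ν + 3 / 2))) := by
          rw [one_div_mul_one_div]; ring_nf
      _ = _ := by
          rw [ih]
          have q1 : 2 * (n : ℝ) + 3 = 2 * ((n : ℝ) + 3 / 2) := by ring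
          have q2 : 2 * (n : ℝ) + 2 * ν + 3 = 2 * ((n : ℝ) + ν + 3 / 2) := by ring
          rw [q1, q2, pow_succ]
          field_simp
          ring

theorem struveH_eq {ν : ℝ} (hν : |ν| < 1 / 2) {x : ℝ} (hx : 0 < x) :
    struveH ν x = 1 / (Real.Gamma (3 / 2) * Real.Gamma (ν + 3 / 2)) * (x / 2) ^ (ν + 1) *
      ∑' n : ℕ, (-1 : ℝ) ^ n * (struveCoeff ν n * x ^ (2 * n)) := by
  rw [struveH, ← tsum_mul_left]
  refine tsum_congr fun n => ?_
  have hx2 : 0 < x / 2 := by positivity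
  have e : (x / 2) ^ (2 * (n : ℝ) + ν + 1) = (x / 2) ^ (2 * n) * (x / 2) ^ (ν + 1) := by
    rw [add_assoc, Real.rpow_add hx2]
    congr 1
    exact_mod_cast Real.rpow_natCast (x / 2) (2 * n)
  have h4 : (2 : ℝ) ^ (2 * n) = 4 ^ n := by rw [pow_mul]; norm_num
  rw [e, ← mul_one_div, one_div_Gamma_mul_Gamma hν, div_pow, h4]
  field_simp

theorem hasDerivAt_struveSeries {ν : ℝ} (hν : |ν| < 1 / 2) (x : ℝ) :
    HasDerivAt (fun y : ℝ => ∑' n : ℕ, (-1 : ℝ) ^ n * (struveCoeff ν n * y ^ (2 * n)))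
      (∑' n : ℕ, (-1 : ℝ) ^ n * (struveCoeff ν n * ((2 * n : ℕ) * x ^ (2 * n - 1)))) x := by
  have h1 := (abs_lt.1 hν).1
  have hx : |x| < |x| + 1 := by linarith
  have hM : 1 ≤ |x| + 1 := by linarith [abs_nonneg x]
  refine hasDerivAt_tsum_of_isPreconnected 
    (g := fun n y => (-1 : ℝ) ^ n * (struveCoeff ν n * y ^ (2 * n)))
    (g' := fun n y => (-1 : ℝ) ^ n * (struveCoeff ν n * ((2 * n : ℕ) * y ^ (2 * n - 1))))
    (t := Set.Ioo (-(|x| + 1)) (|x| + 1)) (y₀ := 0)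
    (u := struveDerivTerm ν ((|x| + 1) ^ 2)) (summable_struveDerivTerm hν (by positivity))
    isOpen_Ioo isPreconnected_Ioo (fun n y _ => ?_) (fun n y hy => ?_)
    (abs_lt.1 (by simpa using by positivity)) ?_ (abs_lt.1 hx)
  · exact ((hasDerivAt_pow (2 * n) y).const_mul _).const_mul _
  · have hn : (0 : ℝ) ≤ n := n.cast_nonneg
    have hc := struveCoeff_pos hν n
    rw [norm_mul, norm_pow, norm_neg, norm_one, one_pow, one_mul, norm_mul, norm_mul, norm_pow,
      Real.norm_of_nonneg hc.le, Real.norm_natCast, Real.norm_eq_abs]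
    have hy' : |y| ≤ |x| + 1 := (abs_lt.2 hy).le
    unfold struveDerivTerm
    calc struveCoeff ν n * ((2 * n : ℕ) * |y| ^ (2 * n - 1))
        ≤ struveCoeff ν n * ((2 * n + ν + 1) * (|x| + 1) ^ (2 * n)) := by
          have hl : ((2 * n : ℕ) : ℝ) ≤ 2 * n + ν + 1 := by push_cast; linarith
          have hp : |y| ^ (2 * n - 1) ≤ (|x| + 1) ^ (2 * n) :=
            (pow_le_pow_left₀ (abs_nonneg y) hy' _).trans
              (pow_le_pow_right₀ hM (Nat.sub_le _ _))
          have hl0 : 0 ≤ 2 * (n : ℝ) + ν + 1 := by linarith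
          gcongr
      _ = _ := by rw [pow_mul]; ring
  · refine summable_of_ne_finset_zero (s := {0}) fun n hn => ?_
    have : n ≠ 0 := by simpa using hn
    simp [this]

/-- Termwise identity `x G'(x) + (ν + 1) G(x) = struveDerivSeries ν (x ^ 2)` for
`G(x) = ∑ (-1)ⁿ cₙ x ^ (2n)`, the power series factor of the Struve function. -/
theorem mul_tsum_deriv_eq {ν : ℝ} (hν : |ν| < 1 / 2) {x : ℝ} :
    x * (∑' n : ℕ, (-1 : ℝ) ^ n * (struveCoeff ν n * ((2 * n : ℕ) * x ^ (2 * n - 1)))) =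
      struveDerivSeries ν (x ^ 2) -
        (ν + 1) * ∑' n : ℕ, (-1 : ℝ) ^ n * (struveCoeff ν n * x ^ (2 * n)) := by
  have h1 := (abs_lt.1 hν).1
  have hS := hasSum_struveDerivSeries hν (sq_nonneg x)
  have hG : Summable fun n : ℕ => (-1 : ℝ) ^ n * (struveCoeff ν n * x ^ (2 * n)) := by
    refine Summable.of_norm_bounded
      ((summable_struveDerivTerm hν (sq_nonneg x)).mul_left (1 / (ν + 1))) fun n => ?_
    have hn : (0 : ℝ) ≤ n := n.cast_nonneg
    have hc := struveCoeff_pos hν n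
    have hp : 0 < ν + 1 := by linarith
    rw [pow_mul, norm_mul, norm_pow, norm_neg, norm_one, one_pow, one_mul,
      Real.norm_of_nonneg (by positivity), struveDerivTerm, one_div_mul_eq_div, le_div_iff₀ hp]
    have hb : 0 ≤ struveCoeff ν n * (x ^ 2) ^ n := by positivity
    nlinarith
  rw [← tsum_mul_left, ← tsum_mul_left, ← hS.tsum_eq,
    ← hS.summable.tsum_sub (hG.mul_left (ν + 1))]
  refine tsum_congr fun n => ?_
  rcases n with _ | n
  · simp [struveDerivTerm]
  · have e : 2 * (n + 1) - 1 = 2 * n + 1 := by omega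
    rw [struveDerivTerm, e]
    push_cast
    ring

theorem deriv_struveH {ν : ℝ} (hν : |ν| < 1 / 2) {x : ℝ} (hx : 0 < x) :
    deriv (struveH ν) x = 1 / (Real.Gamma (3 / 2) * Real.Gamma (ν + 3 / 2)) / 2 * (x / 2) ^ ν *
      struveDerivSeries ν (x ^ 2) := by
  have hx2 : 0 < x / 2 := by positivity
  have hev : struveH ν =ᶠ[𝓝 x] fun y => 1 / (Real.Gamma (3 / 2) * Real.Gamma (ν + 3 / 2)) *
      (y / 2) ^ (ν + 1) * ∑' n : ℕ, (-1 : ℝ) ^ n * (struveCoeff ν n * y ^ (2 * n)) := by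
    filter_upwards [lt_mem_nhds hx] with y hy using struveH_eq hν hy
  have hpow : HasDerivAt (fun y : ℝ => (y / 2) ^ (ν + 1)) (1 / 2 * (ν + 1) * (x / 2) ^ ν) x := by
    simpa using ((hasDerivAt_id x).div_const 2).rpow_const (p := ν + 1) (Or.inl hx2.ne')
  have hd := (hpow.const_mul (1 / (Real.Gamma (3 / 2) * Real.Gamma (ν + 3 / 2)))).mul
    (hasDerivAt_struveSeries hν x)
  rw [hev.deriv_eq]
  refine hd.deriv.trans ?_
  have hm := mul_tsum_deriv_eq hν (x := x)
  rw [Real.rpow_add_one hx2.ne']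
  linear_combination
    1 / (Real.Gamma (3 / 2) * Real.Gamma (ν + 3 / 2)) / 2 * (x / 2) ^ ν * hm

/-! ### Alternating bounds -/

/-- For `z ≤ 9` the terms decrease from index `1` on. Index `0` has to be left out: the ratio of the
first two terms exceeds `1` near the first zero. -/
theorem struveDerivTerm_succ_le {ν : ℝ} (hν : |ν| < 1 / 2) {z : ℝ} (hz : 0 ≤ z)
    (hz9 : z ≤ 9) {n : ℕ} (hn : 1 ≤ n) :
    struveDerivTerm ν z (n + 1) ≤ struveDerivTerm ν z n := by
  obtain ⟨h1, h2⟩ := abs_lt.1 hν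
  have hn' : (1 : ℝ) ≤ n := by exact_mod_cast hn
  have hc := struveCoeff_pos hν n
  have q : 0 < (2 * (n : ℝ) + 3) * (2 * n + 2 * ν + 3) := by
    apply mul_pos <;> linarith
  have e : struveDerivTerm ν z (n + 1) = ((2 * (n : ℝ) + ν + 3) * z) /
      ((2 * (n : ℝ) + 3) * (2 * n + 2 * ν + 3)) * (struveCoeff ν n * z ^ n) := by
    rw [struveDerivTerm, struveCoeff_succ, pow_succ]
    push_cast
    field_simp
    ring
  rw [e, struveDerivTerm, mul_assoc]
  refine mul_le_mul_of_nonneg_right ?_ (by positivity)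
  rw [div_le_iff₀ q]
  have a1 : (2 * (n : ℝ) + ν + 3) * z ≤ (2 * (n : ℝ) + ν + 3) * 9 := by gcongr; linarith
  have a2 : 20 ≤ (2 * (n : ℝ) + 3) * (2 * n + 2 * ν + 3) := by nlinarith
  nlinarith

/-- Leibniz bounds for the alternating series, applied to its tail from index `1`. -/
theorem struveDerivSeries_bounds {ν : ℝ} (hν : |ν| < 1 / 2) {z : ℝ} (hz : 0 ≤ z) (hz9 : z ≤ 9)
    (m : ℕ) :
    struveDerivSeries ν z ≤ ∑ n ∈ range (2 * m + 1), (-1 : ℝ) ^ n * struveDerivTerm ν z n ∧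
    ∑ n ∈ range (2 * m + 2), (-1 : ℝ) ^ n * struveDerivTerm ν z n ≤ struveDerivSeries ν z := by
  have ha : Antitone fun n => struveDerivTerm ν z (n + 1) :=
    antitone_nat_of_succ_le fun n => struveDerivTerm_succ_le hν hz hz9 n.succ_pos
  have hs := hasSum_struveDerivSeries hν hz
  have e (N : ℕ) : ∑ n ∈ range (N + 1), (-1 : ℝ) ^ n * struveDerivTerm ν z n =
      struveDerivTerm ν z 0 - ∑ n ∈ range N, (-1 : ℝ) ^ n * struveDerivTerm ν z (n + 1) := by
    rw [sum_range_succ']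
    simp only [pow_succ, mul_neg, mul_one, neg_mul, sum_neg_distrib, pow_zero, one_mul]
    ring
  have ht : Tendsto (fun N => ∑ n ∈ range N, (-1 : ℝ) ^ n * struveDerivTerm ν z (n + 1)) atTop
      (𝓝 (struveDerivTerm ν z 0 - struveDerivSeries ν z)) := by
    have h := (hs.tendsto_sum_nat.comp (tendsto_add_atTop_nat 1)).const_sub
      (struveDerivTerm ν z 0)
    refine h.congr fun N => ?_
    rw [Function.comp_apply, e]
    ring
  have hlo := ha.alternating_series_le_tendsto ht m
  have hup := ha.tendsto_le_alternating_series ht m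
  constructor
  · rw [e]; linarith
  · rw [e]; linarith

/-! ### Polynomial inequalities in the order -/

/-- A cubic which, multiplied by `3(2ν+3)(ν+1)` and evaluated at `t = ν + 1/2 ∈ (0, 1)`, lies between
the cube root lower bound and the first zero of `struveDerivSeries ν`. Its rounded
coefficients come from interpolation at `t = 0, 3/10, 7/10, 1` inside this gap, whose relative width
is below `10⁻⁴` near `t = 0`. -/
noncomputable def lowerProfile (t : ℝ) : ℝ :=
  0.45282 - 0.05605 * t + 0.04546 * t ^ 2 - 0.01178 * t ^ 3

/-- A quadratic which, multiplied by `3(2ν+3)(ν+1)` and evaluated at `t = ν + 1/2 ∈ (0, 1)`, lies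
between the first zero of `struveDerivSeries ν` and both upper bounds. -/
noncomputable def upperProfile (t : ℝ) : ℝ := 0.4537 - 0.0473 * t + 0.0357 * t ^ 2

/-- Rational parametrization of `-1/2 < ν < 1/2` by `u > 0`. After this substitution the numerators
of all polynomial inequalities below have only positive coefficients in `u`. -/
theorem exists_pos_param {ν : ℝ} (hν : |ν| < 1 / 2) :
    ∃ u : ℝ, 0 < u ∧ ν + 1 / 2 = u / (u + 1) ∧ ν = (u - 1) / (2 * (u + 1)) := by
  obtain ⟨h1, h2⟩ := abs_lt.1 hν
  have h3 : 1 - 2 * ν ≠ 0 := by linarith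
  refine ⟨(1 + 2 * ν) / (1 - 2 * ν), div_pos (by linarith) (by linarith), ?_, ?_⟩
  · rw [div_add_one h3, div_div_div_cancel_right₀ h3]; ring
  · rw [div_add_one h3, div_sub_one h3, ← mul_div_assoc, div_div_div_cancel_right₀ h3]; ring

theorem lt_lowerProfile_cube_mul {ν : ℝ} (hν : |ν| < 1 / 2) :
    35 * (2 * ν + 5) * (2 * ν + 7) <
      lowerProfile (ν + 1 / 2) ^ 3 *
        (-4 * ν ^ 5 - 132 * ν ^ 4 - 1115 * ν ^ 3 + 621 * ν ^ 2 + 12339 * ν + 14931) := by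
  obtain ⟨u, hu, ht, hu'⟩ := exists_pos_param hν
  rw [← sub_pos, ht, lowerProfile, hu']
  field_simp
  ring_nf
  positivity

theorem lt_lowerProfile_sq_mul {ν : ℝ} (hν : |ν| < 1 / 2) :
    5 * (2 * ν + 5) <
      lowerProfile (ν + 1 / 2) ^ 2 * (-2 * ν ^ 3 - 5 * ν ^ 2 + 72 * ν + 135) := by
  obtain ⟨u, hu, ht, hu'⟩ := exists_pos_param hν
  rw [← sub_pos, ht, lowerProfile, hu']
  field_simp
  ring_nf
  positivity

theorem one_lt_lowerProfile_mul {ν : ℝ} (hν : |ν| < 1 / 2) :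
    1 < lowerProfile (ν + 1 / 2) * (ν + 3) := by
  obtain ⟨u, hu, ht, hu'⟩ := exists_pos_param hν
  rw [← sub_pos, ht, lowerProfile, hu']
  field_simp
  ring_nf
  positivity

/-- Positivity of the partial sum of degree `5` of `struveDerivSeries ν` at
`3(2ν+3)(ν+1) * lowerProfile (ν + 1/2)`, with denominators cleared. -/
theorem lowerProfile_truncation_pos {ν : ℝ} (hν : |ν| < 1 / 2) :
    0 <
      (5 * (2 * ν + 5)) * (7 * (2 * ν + 7)) * (9 * (2 * ν + 9)) * (11 * (2 * ν + 11))
      - (ν + 3) * lowerProfile (ν + 1 / 2) * (5 * (2 * ν + 5)) * (7 * (2 * ν + 7)) *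
          (9 * (2 * ν + 9)) * (11 * (2 * ν + 11))
      + (ν + 5) * (3 * (2 * ν + 3) * (ν + 1)) * lowerProfile (ν + 1 / 2) ^ 2 * (7 * (2 * ν + 7)) *
          (9 * (2 * ν + 9)) * (11 * (2 * ν + 11))
      - (ν + 7) * (3 * (2 * ν + 3) * (ν + 1)) ^ 2 * lowerProfile (ν + 1 / 2) ^ 3 *
          (9 * (2 * ν + 9)) * (11 * (2 * ν + 11))
      + (ν + 9) * (3 * (2 * ν + 3) * (ν + 1)) ^ 3 * lowerProfile (ν + 1 / 2) ^ 4 *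
          (11 * (2 * ν + 11))
      - (ν + 11) * (3 * (2 * ν + 3) * (ν + 1)) ^ 4 * lowerProfile (ν + 1 / 2) ^ 5 := by
  obtain ⟨u, hu, ht, hu'⟩ := exists_pos_param hν
  rw [← sub_pos, ht, lowerProfile, hu']
  field_simp
  ring_nf
  positivity

theorem upperProfile_mul_quintic_lt {ν : ℝ} (hν : |ν| < 1 / 2) :
    upperProfile (ν + 1 / 2) *
        (-4 * ν ^ 5 - 132 * ν ^ 4 - 1115 * ν ^ 3 + 621 * ν ^ 2 + 12339 * ν + 14931) <
      7 * (2 * ν + 7) * (-2 * ν ^ 3 - 5 * ν ^ 2 + 72 * ν + 135) := by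
  obtain ⟨u, hu, ht, hu'⟩ := exists_pos_param hν
  rw [← sub_pos, ht, upperProfile, hu']
  field_simp
  ring_nf
  positivity

theorem upperProfile_mul_cubic_lt {ν : ℝ} (hν : |ν| < 1 / 2) :
    upperProfile (ν + 1 / 2) * (-2 * ν ^ 3 - 5 * ν ^ 2 + 72 * ν + 135) <
      5 * (2 * ν + 5) * (ν + 3) := by
  obtain ⟨u, hu, ht, hu'⟩ := exists_pos_param hν
  rw [← sub_pos, ht, upperProfile, hu']
  field_simp
  ring_nf
  positivity

/-- Negativity of the partial sum of degree `4` of `struveDerivSeries ν` at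
`3(2ν+3)(ν+1) * upperProfile (ν + 1/2)`, with denominators cleared. -/
theorem upperProfile_truncation_neg {ν : ℝ} (hν : |ν| < 1 / 2) :
    (5 * (2 * ν + 5)) * (7 * (2 * ν + 7)) * (9 * (2 * ν + 9))
      - (ν + 3) * upperProfile (ν + 1 / 2) * (5 * (2 * ν + 5)) * (7 * (2 * ν + 7)) *
          (9 * (2 * ν + 9))
      + (ν + 5) * (3 * (2 * ν + 3) * (ν + 1)) * upperProfile (ν + 1 / 2) ^ 2 * (7 * (2 * ν + 7)) *
          (9 * (2 * ν + 9))
      - (ν + 7) * (3 * (2 * ν + 3) * (ν + 1)) ^ 2 * upperProfile (ν + 1 / 2) ^ 3 * (9 * (2 * ν + 9))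
      + (ν + 9) * (3 * (2 * ν + 3) * (ν + 1)) ^ 3 * upperProfile (ν + 1 / 2) ^ 4 <
      0 := by
  obtain ⟨u, hu, ht, hu'⟩ := exists_pos_param hν
  rw [← sub_pos, ht, upperProfile, hu']
  field_simp
  ring_nf
  positivity

theorem lowerProfile_pos {ν : ℝ} (hν : |ν| < 1 / 2) : 0 < lowerProfile (ν + 1 / 2) := by
  obtain ⟨u, hu, ht, -⟩ := exists_pos_param hν
  rw [ht, lowerProfile]
  field_simp
  ring_nf
  positivity

theorem lowerProfile_lt_upperProfile {ν : ℝ} (hν : |ν| < 1 / 2) :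
    lowerProfile (ν + 1 / 2) < upperProfile (ν + 1 / 2) := by
  obtain ⟨u, hu, ht, -⟩ := exists_pos_param hν
  rw [← sub_pos, ht, lowerProfile, upperProfile]
  field_simp
  ring_nf
  positivity

theorem upperProfile_lt {ν : ℝ} (hν : |ν| < 1 / 2) : upperProfile (ν + 1 / 2) < 46 / 100 := by
  obtain ⟨u, hu, ht, -⟩ := exists_pos_param hν
  rw [← sub_pos, ht, upperProfile]
  field_simp
  ring_nf
  positivity

/-! ### Sign of the series on both sides of its first zero -/

/-- The partial sum of degree `5` decreases up to `3(2ν+3)(ν+1) * 46/100`, a bound for the range in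
which it is used: its linear term dominates the derivatives of the terms of degree `2` and `4`. -/
theorem truncation_antitone {ν : ℝ} (hν : |ν| < 1 / 2) {y Z : ℝ} (hy : 0 ≤ y) (hyZ : y ≤ Z)
    (hZ : Z ≤ 3 * (2 * ν + 3) * (ν + 1) * (46 / 100)) :
    ∑ n ∈ range 6, (-1 : ℝ) ^ n * struveDerivTerm ν Z n ≤
      ∑ n ∈ range 6, (-1 : ℝ) ^ n * struveDerivTerm ν y n := by
  obtain ⟨h1, h2⟩ := abs_lt.1 hν
  have hZ0 := hy.trans hyZ
  have hc (n : ℕ) : 0 ≤ (2 * (n : ℝ) + ν + 1) * struveCoeff ν n := by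
    simpa [struveDerivTerm] using struveDerivTerm_nonneg hν zero_le_one n
  -- The ratios `0.44`, `1/4`, `1/4` suffice because `2 * 0.44 + 4 * 0.44 / 16 < 1`.
  have ratio (n : ℕ) (q : ℝ)
      (h : (2 * (n : ℝ) + ν + 3) * (3 * (2 * ν + 3) * (ν + 1) * (46 / 100)) ≤
        q * ((2 * n + ν + 1) * ((2 * n + 3) * (2 * n + 2 * ν + 3)))) :
      (2 * ((n + 1 : ℕ) : ℝ) + ν + 1) * struveCoeff ν (n + 1) * Z ≤
        q * ((2 * (n : ℝ) + ν + 1) * struveCoeff ν n) := by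
    have hn : (0 : ℝ) ≤ n := n.cast_nonneg
    have hs := struveCoeff_pos hν n
    have hq : 0 < (2 * (n : ℝ) + 3) * (2 * n + 2 * ν + 3) := by apply mul_pos <;> linarith
    have hl : 0 ≤ 2 * (n : ℝ) + ν + 3 := by linarith
    calc _ = (2 * (n : ℝ) + ν + 3) * Z / ((2 * (n : ℝ) + 3) * (2 * n + 2 * ν + 3)) *
          struveCoeff ν n := by
          rw [struveCoeff_succ]; push_cast; ring
      _ ≤ (q * (2 * n + ν + 1)) * struveCoeff ν n := by
          gcongr
          rw [div_le_iff₀ hq]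
          linarith [mul_le_mul_of_nonneg_left hZ hl]
      _ = _ := by ring
  have r1 := ratio 1 (44 / 100) (by norm_num; nlinarith [sq_nonneg ν, sq_nonneg (ν - 1 / 2)])
  have r2 := ratio 2 (1 / 4) (by norm_num; nlinarith [sq_nonneg ν, sq_nonneg (ν - 1 / 2)])
  have r3 := ratio 3 (1 / 4) (by norm_num; nlinarith [sq_nonneg ν, sq_nonneg (ν - 1 / 2)])
  simp only [sum_range_succ, sum_range_zero, struveDerivTerm]
  have c1 := hc 1
  have c2 := hc 2
  have c3 := hc 3
  have c4 := hc 4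
  have c5 := hc 5
  norm_num at r1 r2 r3 c1 c2 c3 c4 c5 ⊢
  generalize (2 + ν + 1) * struveCoeff ν 1 = a1 at *
  generalize (4 + ν + 1) * struveCoeff ν 2 = a2 at *
  generalize (6 + ν + 1) * struveCoeff ν 3 = a3 at *
  generalize (8 + ν + 1) * struveCoeff ν 4 = a4 at *
  generalize (10 + ν + 1) * struveCoeff ν 5 = a5 at *
  have p3 : a3 * y ^ 3 ≤ a3 * Z ^ 3 := by gcongr
  have p5 : a5 * y ^ 5 ≤ a5 * Z ^ 5 := by gcongr
  have hd : 0 ≤ Z - y := sub_nonneg.2 hyZ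
  have p2 : a2 * (Z ^ 2 - y ^ 2) ≤ a2 * (2 * Z * (Z - y)) := by gcongr; nlinarith
  have p4 : a4 * (Z ^ 4 - y ^ 4) ≤ a4 * (4 * Z ^ 3 * (Z - y)) := by
    gcongr
    have e2 : y ^ 2 ≤ Z ^ 2 := by gcongr
    have e3 : y ^ 3 ≤ Z ^ 3 := by gcongr
    have e : Z ^ 4 - y ^ 4 = (Z ^ 3 + Z ^ 2 * y + Z * y ^ 2 + y ^ 3) * (Z - y) := by ring
    rw [e]
    gcongr
    nlinarith [mul_le_mul_of_nonneg_left e2 hZ0,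
      mul_le_mul_of_nonneg_left hyZ (sq_nonneg Z)]
  have hkey : 2 * (a2 * Z) + 4 * (a4 * Z ^ 3) ≤ a1 := by
    have e1 : a4 * Z ^ 3 ≤ 1 / 4 * a3 * Z ^ 2 := by
      nlinarith [mul_le_mul_of_nonneg_right r3 (sq_nonneg Z)]
    have e2 : a3 * Z ^ 2 ≤ 1 / 4 * a2 * Z := by
      nlinarith [mul_le_mul_of_nonneg_right r2 hZ0]
    linarith
  have := mul_le_mul_of_nonneg_right hkey hd
  linarith

theorem scaled_profile_le_nine {ν y : ℝ} (hν : |ν| < 1 / 2) (hy0 : 0 ≤ y) (hy : y ≤ 46 / 100) :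
    3 * (2 * ν + 3) * (ν + 1) * y ≤ 9 := by
  obtain ⟨h1, h2⟩ := abs_lt.1 hν
  have : 3 * (2 * ν + 3) * (ν + 1) ≤ 18 := by nlinarith
  nlinarith

theorem struveDerivSeries_pos {ν z : ℝ} (hν : |ν| < 1 / 2) (hz : 0 ≤ z)
    (hzl : z ≤ 3 * (2 * ν + 3) * (ν + 1) * lowerProfile (ν + 1 / 2)) :
    0 < struveDerivSeries ν z := by
  obtain ⟨h1, h2⟩ := abs_lt.1 hν
  have hl := lowerProfile_pos hν
  have hl' := (lowerProfile_lt_upperProfile hν).trans (upperProfile_lt hν)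
  have hD : 0 < 3 * (2 * ν + 3) * (ν + 1) := by
    apply mul_pos <;> linarith
  refine lt_of_lt_of_le ?_ ((struveDerivSeries_bounds hν hz
    (hzl.trans (scaled_profile_le_nine hν hl.le hl'.le)) 2).2)
  refine lt_of_lt_of_le ?_ (truncation_antitone hν hz hzl (by gcongr))
  have hp := lowerProfile_truncation_pos hν
  have d1 : 0 < 2 * ν + 3 := by linarith
  have d2 : 0 < 2 * ν + 5 := by linarith
  have d3 : 0 < 2 * ν + 7 := by linarith
  have d4 : 0 < 2 * ν + 9 := by linarith
  have d5 : 0 < 2 * ν + 11 := by linarith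
  have d0 : 0 < ν + 1 := by linarith
  have hq := mul_pos hp (show 0 < (ν + 1) /
    ((5 * (2 * ν + 5)) * (7 * (2 * ν + 7)) * (9 * (2 * ν + 9)) * (11 * (2 * ν + 11))) by positivity)
  refine hq.trans_eq ?_
  simp only [sum_range_succ, sum_range_zero, struveDerivTerm, struveCoeff, prod_range_succ,
    prod_range_zero]
  generalize lowerProfile (ν + 1 / 2) = v
  push_cast
  have e1 : 2 * 1 + 2 * ν + 3 = 2 * ν + 5 := by ring
  have e2 : 2 * 2 + 2 * ν + 3 = 2 * ν + 7 := by ring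
  have e3 : 2 * 3 + 2 * ν + 3 = 2 * ν + 9 := by ring
  have e4 : 2 * 4 + 2 * ν + 3 = 2 * ν + 11 := by ring
  have e0 : 2 * 0 + 2 * ν + 3 = 2 * ν + 3 := by ring
  rw [e0, e1, e2, e3, e4]
  field_simp
  ring

theorem struveDerivSeries_neg {ν : ℝ} (hν : |ν| < 1 / 2) :
    struveDerivSeries ν (3 * (2 * ν + 3) * (ν + 1) * upperProfile (ν + 1 / 2)) < 0 := by
  obtain ⟨h1, h2⟩ := abs_lt.1 hν
  have hu := (lowerProfile_pos hν).trans (lowerProfile_lt_upperProfile hν)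
  have d1 : 0 < 2 * ν + 3 := by linarith
  have d2 : 0 < 2 * ν + 5 := by linarith
  have d3 : 0 < 2 * ν + 7 := by linarith
  have d4 : 0 < 2 * ν + 9 := by linarith
  have d0 : 0 < ν + 1 := by linarith
  refine lt_of_le_of_lt ((struveDerivSeries_bounds hν (by positivity)
    (scaled_profile_le_nine hν hu.le (upperProfile_lt hν).le) 2).1) ?_
  have hq := mul_neg_of_neg_of_pos (upperProfile_truncation_neg hν) (show 0 < (ν + 1) /
    ((5 * (2 * ν + 5)) * (7 * (2 * ν + 7)) * (9 * (2 * ν + 9))) by positivity)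
  refine hq.trans_eq' ?_
  simp only [sum_range_succ, sum_range_zero, struveDerivTerm, struveCoeff, prod_range_succ,
    prod_range_zero]
  generalize upperProfile (ν + 1 / 2) = v
  push_cast
  have e1 : 2 * 1 + 2 * ν + 3 = 2 * ν + 5 := by ring
  have e2 : 2 * 2 + 2 * ν + 3 = 2 * ν + 7 := by ring
  have e3 : 2 * 3 + 2 * ν + 3 = 2 * ν + 9 := by ring
  have e0 : 2 * 0 + 2 * ν + 3 = 2 * ν + 3 := by ring
  rw [e0, e1, e2, e3]
  field_simp
  ring

/-! ### The smallest zero -/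

/-- A continuous function that is positive on `(0, a]` and negative at `b > a` has a smallest positive
zero, which lies in `(a, b)`. -/
theorem exists_isLeast_pos_zero {f : ℝ → ℝ} (hf : Continuous f) {a b : ℝ} (ha : 0 < a)
    (hab : a < b) (hpos : ∀ x, 0 < x → x ≤ a → 0 < f x) (hb : f b < 0) :
    ∃ h, IsLeast {x : ℝ | 0 < x ∧ f x = 0} h ∧ a < h ∧ h < b := by
  have hK : IsCompact (Set.Icc a b ∩ f ⁻¹' {0}) :=
    isCompact_Icc.inter_right (isClosed_singleton.preimage hf)
  obtain ⟨c, hc, hc0⟩ := intermediate_value_Icc' hab.le hf.continuousOn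
    ⟨hb.le, (hpos a ha le_rfl).le⟩
  obtain ⟨h, ⟨⟨hha, hhb⟩, hh0⟩, hmin⟩ := hK.exists_isLeast ⟨c, hc, hc0⟩
  have hh0 : f h = 0 := hh0
  have lt_of_zero {x : ℝ} (hx : 0 < x) (hx0 : f x = 0) : a < x := by
    by_contra! hxa
    exact (hpos x hx hxa).ne' hx0
  have hh : 0 < h := ha.trans_le hha
  refine ⟨h, ⟨⟨hh, hh0⟩, fun x hx => ?_⟩, lt_of_zero hh hh0, hhb.lt_of_ne ?_⟩
  · rcases le_total x b with hxb | hxb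
    · exact hmin ⟨⟨(lt_of_zero hx.1 hx.2).le, hxb⟩, hx.2⟩
    · exact hhb.trans hxb
  · rintro rfl
    exact hb.ne hh0

/-- Two-sided polynomial enclosure of the square of the first zero of the derivative, from which all
five bounds follow. -/
theorem exists_isLeast_deriv_struveH {ν : ℝ} (hν : |ν| < 1 / 2) :
    ∃ h : ℝ, IsLeast {x : ℝ | 0 < x ∧ deriv (struveH ν) x = 0} h ∧
      3 * (2 * ν + 3) * (ν + 1) * lowerProfile (ν + 1 / 2) < h ^ 2 ∧
      h ^ 2 < 3 * (2 * ν + 3) * (ν + 1) * upperProfile (ν + 1 / 2) := by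
  obtain ⟨h1, h2⟩ := abs_lt.1 hν
  have hl := lowerProfile_pos hν
  have hu := hl.trans (lowerProfile_lt_upperProfile hν)
  have hD : 0 < 3 * (2 * ν + 3) * (ν + 1) := by
    apply mul_pos <;> linarith
  have hset : {x : ℝ | 0 < x ∧ deriv (struveH ν) x = 0} =
      {x : ℝ | 0 < x ∧ struveDerivSeries ν (x ^ 2) = 0} := by
    ext x
    refine and_congr_right fun hx => ?_
    have g1 := Real.Gamma_pos_of_pos (show (0 : ℝ) < 3 / 2 by norm_num)
    have g2 := Real.Gamma_pos_of_pos (show 0 < ν + 3 / 2 by linarith)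
    have hx2 : 0 < (x / 2) ^ ν := Real.rpow_pos_of_pos (by positivity) _
    rw [deriv_struveH hν hx, mul_eq_zero_iff_left (by positivity)]
  obtain ⟨h, hh, hlo, hup⟩ := exists_isLeast_pos_zero (continuous_struveDerivSeries_sq hν)
    (Real.sqrt_pos.2 (mul_pos hD hl))
    (Real.sqrt_lt_sqrt (mul_pos hD hl).le
      (mul_lt_mul_of_pos_left (lowerProfile_lt_upperProfile hν) hD))
    (fun x hx hxa => struveDerivSeries_pos hν (sq_nonneg x) ((Real.le_sqrt' hx).1 hxa))
    (by rw [Real.sq_sqrt (mul_pos hD hu).le]; exact struveDerivSeries_neg hν)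
  refine ⟨h, hset ▸ hh, (Real.sqrt_lt' hh.1.1).1 hlo, (Real.lt_sqrt hh.1.1.le).1 hup⟩

theorem theorem2 (ν : ℝ) (hν : |ν| < 1 / 2) :
    ∃ h : ℝ, IsLeast {x : ℝ | 0 < x ∧ deriv (struveH ν) x = 0} h ∧
      3 * (2 * ν + 3) * (ν + 1) / (ν + 3) < h ^ 2 ∧
      3 * (2 * ν + 3) * (ν + 1) * Real.sqrt (5 * (2 * ν + 5)) /
          Real.sqrt (-2 * ν ^ 3 - 5 * ν ^ 2 + 72 * ν + 135) < h ^ 2 ∧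
      3 * (2 * ν + 3) * (ν + 1) * (35 * (2 * ν + 5) * (2 * ν + 7)) ^ (1 / 3 : ℝ) /
          (-4 * ν ^ 5 - 132 * ν ^ 4 - 1115 * ν ^ 3 + 621 * ν ^ 2 + 12339 * ν + 14931)
            ^ (1 / 3 : ℝ) < h ^ 2 ∧
      h ^ 2 < 15 * (2 * ν + 3) * (2 * ν + 5) * (ν + 1) * (ν + 3) /
          (-2 * ν ^ 3 - 5 * ν ^ 2 + 72 * ν + 135) ∧
      h ^ 2 < 21 * (2 * ν + 3) * (2 * ν + 7) * (ν + 1) *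
            (-2 * ν ^ 3 - 5 * ν ^ 2 + 72 * ν + 135) /
          (-4 * ν ^ 5 - 132 * ν ^ 4 - 1115 * ν ^ 3 + 621 * ν ^ 2 + 12339 * ν + 14931) := by
  obtain ⟨h1, h2⟩ := abs_lt.1 hν
  obtain ⟨h, hh, hlo, hup⟩ := exists_isLeast_deriv_struveH hν
  have hl := lowerProfile_pos hν
  have hD : 0 < 3 * (2 * ν + 3) * (ν + 1) := by
    apply mul_pos <;> linarith
  have b1 := one_lt_lowerProfile_mul hν
  have b2 := lt_lowerProfile_sq_mul hν
  have b3 := lt_lowerProfile_cube_mul hν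
  have c1 := upperProfile_mul_cubic_lt hν
  have c2 := upperProfile_mul_quintic_lt hν
  have d2 : 0 < 2 * ν + 5 := by linarith
  have d3 : 0 < 2 * ν + 7 := by linarith
  have hP3 : 0 < -2 * ν ^ 3 - 5 * ν ^ 2 + 72 * ν + 135 :=
    pos_of_mul_pos_right ((by positivity : 0 < 5 * (2 * ν + 5)).trans b2) (by positivity)
  have hP5 : 0 < -4 * ν ^ 5 - 132 * ν ^ 4 - 1115 * ν ^ 3 + 621 * ν ^ 2 + 12339 * ν + 14931 :=
    pos_of_mul_pos_right ((by positivity : 0 < 35 * (2 * ν + 5) * (2 * ν + 7)).trans b3)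
      (by positivity)
  generalize lowerProfile (ν + 1 / 2) = v at *
  generalize upperProfile (ν + 1 / 2) = w at *
  generalize -2 * ν ^ 3 - 5 * ν ^ 2 + 72 * ν + 135 = P at *
  generalize -4 * ν ^ 5 - 132 * ν ^ 4 - 1115 * ν ^ 3 + 621 * ν ^ 2 + 12339 * ν + 14931 = Q at *
  refine ⟨h, hh, hlo.trans' ?_, hlo.trans' ?_, hlo.trans' ?_, hup.trans ?_, hup.trans ?_⟩
  · rw [div_lt_iff₀ (by linarith)]
    linarith [mul_lt_mul_of_pos_left b1 hD]
  · rw [mul_div_assoc, ← Real.sqrt_div (by positivity)]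
    refine mul_lt_mul_of_pos_left ((Real.sqrt_lt' hl).2 ?_) hD
    rwa [div_lt_iff₀ hP3]
  · rw [mul_div_assoc, ← Real.div_rpow (by positivity) hP5.le]
    refine mul_lt_mul_of_pos_left ?_ hD
    rw [one_div, Real.rpow_inv_lt_iff_of_pos (by positivity) hl.le (by norm_num),
      div_lt_iff₀ hP5]
    exact_mod_cast b3
  · rw [lt_div_iff₀ hP3]
    linarith [mul_lt_mul_of_pos_left c1 hD]
  · rw [lt_div_iff₀ hP5]
    linarith [mul_lt_mul_of_pos_left c2 hD]
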